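/- Let $G$ be a finite simple graph without isolated vertices, with maximum degree $\Delta(G)$. For an edge colouring $c$ of $G$ (not necessarily proper), say that an edge $uv$ is satisfied if some colour is assigned to exactly one edge of $E[uv]$, the set of all edges incident to $u$ or $v$ (including $uv$ itself); $c$ is conflict-free if every edge of $G$ is satisfied. Let $\chi'_{CF}(G)$ be the least number of colours in a conflict-free edge colouring of $G$. Then $$\chi'_{CF}(G)\le 3\lceil \log_2\Delta(G)\rceil+1.$$ -/

import Mathlib

namespace SimpleGraph

/-- The closed neighbourhood `E[e]` of an edge `e = uv`: all edges incident to `u` or to `v`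
(in particular `e` itself), i.e. all edges sharing an endpoint with `e`. -/
def edgeClosedNbhd {V : Type*} (G : SimpleGraph V) (e : G.edgeSet) : Set G.edgeSet :=
  {f | ∃ v : V, v ∈ (e : Sym2 V) ∧ v ∈ (f : Sym2 V)}

/-- An edge `e` is satisfied by the (not necessarily proper) edge colouring `c` if some colour is
assigned to exactly one edge of the closed neighbourhood of `e`. -/
def EdgeSatisfied {V C : Type*} (G : SimpleGraph V) (c : G.edgeSet → C) (e : G.edgeSet) : Prop :=
  ∃ a : C, ∃! f : G.edgeSet, f ∈ G.edgeClosedNbhd e ∧ c f = a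

/-- An edge colouring is conflict-free if it satisfies every edge. -/
def IsConflictFreeEdgeColoring {V C : Type*} (G : SimpleGraph V) (c : G.edgeSet → C) : Prop :=
  ∀ e : G.edgeSet, G.EdgeSatisfied c e

/-- The conflict-free chromatic index: the least number of colours admitting a conflict-free edge
colouring (`⊤` if no finite number of colours suffices). -/
noncomputable def conflictFreeChromaticIndex {V : Type*} (G : SimpleGraph V) : ℕ∞ :=
  ⨅ k ∈ {k : ℕ | ∃ c : G.edgeSet → Fin k, G.IsConflictFreeEdgeColoring c}, (k : ℕ∞)

end SimpleGraph

open SimpleGraph Set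
open scoped Matrix

/-!
Some cut contains at least half of the edges at every vertex: take a sign vector on the vertices
minimising the quadratic form of the adjacency matrix, as flipping a single sign cannot decrease
it. Removing such cuts repeatedly splits a graph with maximum degree at most `2 ^ k`, `k ≥ 1`, into
`k - 1` bipartite graphs and a graph with maximum degree at most `2`. Each piece gets two colours
of its own that satisfy all its edges while leaving some of them uncoloured, and one last colour
goes to all uncoloured edges.

In a bipartite graph with sides `A` and `B`, a minimal `T ⊆ A` dominating the non-isolated part of
`B` provides every `t ∈ T` with a private neighbour. The first colour is the matching of `T` to
private neighbours, the second joins each other non-isolated vertex of `B` to one vertex of `T`.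
For maximum degree at most `2`, the first colour is a maximal set of edges of which no two meet a
common edge, the second a maximal matching among the edges that the first one does not satisfy.
-/

/-- `MeetsOnce M e` says that exactly one edge of `M` shares an endpoint with `e`. With `M` the set
of edges of one colour, this is how that colour satisfies `e`. -/
def MeetsOnce {V : Type*} (M : Set (Sym2 V)) (e : Sym2 V) : Prop :=
  ∃! f, f ∈ M ∧ ∃ v, v ∈ e ∧ v ∈ f

/-- A partial edge colouring of `G` satisfying every edge, encoded as the family of its colour
classes; edges in no class are uncoloured. -/
structure IsConflictFreeFamily {V ι : Type*} (G : SimpleGraph V) (M : ι → Set (Sym2 V)) :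
    Prop where
  subset_edgeSet : ∀ i, M i ⊆ G.edgeSet
  pairwise_disjoint : Pairwise (Function.onFun Disjoint M)
  exists_meetsOnce : ∀ e ∈ G.edgeSet, ∃ i, MeetsOnce (M i) e

namespace IsConflictFreeFamily

variable {V : Type*} {G H : SimpleGraph V}

theorem of_pair {M N : Set (Sym2 V)} (hM : M ⊆ G.edgeSet) (hN : N ⊆ G.edgeSet)
    (hMN : Disjoint M N) (h : ∀ e ∈ G.edgeSet, MeetsOnce M e ∨ MeetsOnce N e) :
    IsConflictFreeFamily G ![M, N] where
  subset_edgeSet := Fin.forall_fin_two.2 ⟨hM, hN⟩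
  pairwise_disjoint := by
    simp [Pairwise, Fin.forall_fin_two, Function.onFun, hMN, hMN.symm]
  exists_meetsOnce e he := Fin.exists_fin_two.2 (h e he)

theorem append {m n : ℕ} {M : Fin m → Set (Sym2 V)} {N : Fin n → Set (Sym2 V)}
    (hM : IsConflictFreeFamily G M) (hN : IsConflictFreeFamily H N) (hGH : Disjoint G H) :
    IsConflictFreeFamily (G ⊔ H) (Fin.append M N) where
  subset_edgeSet i := by
    rw [edgeSet_sup]
    induction i using Fin.addCases with
    | left i => simpa using (hM.subset_edgeSet i).trans subset_union_left
    | right i => simpa using (hN.subset_edgeSet i).trans subset_union_right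
  pairwise_disjoint i j hij := by
    have hMN (i j) : Disjoint (M i) (N j) :=
      (disjoint_edgeSet.2 hGH).mono (hM.subset_edgeSet i) (hN.subset_edgeSet j)
    induction i using Fin.addCases with
    | left i =>
      induction j using Fin.addCases with
      | left j => simpa [Function.onFun] using hM.pairwise_disjoint (by simpa using hij)
      | right j => simpa [Function.onFun] using hMN i j
    | right i =>
      induction j using Fin.addCases with
      | left j => simpa [Function.onFun] using (hMN j i).symm
      | right j => simpa [Function.onFun] using hN.pairwise_disjoint (by simpa using hij)
  exists_meetsOnce e he := by
    rw [edgeSet_sup] at he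
    obtain he | he := he
    · obtain ⟨i, hi⟩ := hM.exists_meetsOnce e he
      exact ⟨i.castAdd n, by simpa using hi⟩
    · obtain ⟨i, hi⟩ := hN.exists_meetsOnce e he
      exact ⟨i.natAdd m, by simpa using hi⟩

end IsConflictFreeFamily

theorem conflictFreeChromaticIndex_le_of_coloring {V : Type*} {G : SimpleGraph V} {k : ℕ}
    {c : G.edgeSet → Fin k} (hc : G.IsConflictFreeEdgeColoring c) :
    G.conflictFreeChromaticIndex ≤ k :=
  biInf_le (fun k : ℕ ↦ (k : ℕ∞)) ⟨c, hc⟩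

theorem IsConflictFreeFamily.conflictFreeChromaticIndex_le {V : Type*} {G : SimpleGraph V} {n : ℕ}
    {M : Fin n → Set (Sym2 V)} (hM : IsConflictFreeFamily G M) :
    G.conflictFreeChromaticIndex ≤ (n + 1 : ℕ) := by
  classical
  let c (f : G.edgeSet) : Fin (n + 1) :=
    if h : ∃ i, (f : Sym2 V) ∈ M i then h.choose.succ else 0
  have hc (f : G.edgeSet) (i : Fin n) : c f = i.succ ↔ (f : Sym2 V) ∈ M i := by
    by_cases h : ∃ j, (f : Sym2 V) ∈ M j
    · simp only [c, dif_pos h, Fin.succ_inj]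
      refine ⟨fun hi ↦ hi ▸ h.choose_spec, fun hi ↦ ?_⟩
      exact hM.pairwise_disjoint.eq (not_disjoint_iff.2 ⟨f, h.choose_spec, hi⟩)
    · simpa only [c, dif_neg h, (Fin.succ_ne_zero i).symm, false_iff] using not_exists.1 h i
  refine conflictFreeChromaticIndex_le_of_coloring (c := c) fun e ↦ ?_
  obtain ⟨i, f, ⟨hf, hef⟩, huniq⟩ := hM.exists_meetsOnce e e.2
  refine ⟨i.succ, ⟨f, hM.subset_edgeSet i hf⟩, ⟨hef, (hc _ i).2 hf⟩, fun g hg ↦ ?_⟩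
  exact Subtype.ext (huniq g ⟨(hc g i).1 hg.2, hg.1⟩)

theorem exists_dominating_forall_exists_private {α β : Type*} [Finite α] (r : α → β → Prop) :
    ∃ T : Set α, (∀ a b, r a b → ∃ t ∈ T, r t b) ∧
      ∀ t ∈ T, ∃ b, r t b ∧ ∀ u ∈ T, r u b → u = t := by
  let Dominates (T : Set α) : Prop := ∀ a b, r a b → ∃ t ∈ T, r t b
  have hmono ⦃S T : Set α⦄ (hT : Dominates T) (hTS : T ⊆ S) : Dominates S := fun a b hab ↦
    let ⟨t, ht, htb⟩ := hT a b hab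
    ⟨t, hTS ht, htb⟩
  obtain ⟨T, -, hT⟩ := Finite.exists_le_minimal (p := Dominates) (a := univ)
    fun a b hab ↦ ⟨a, mem_univ a, hab⟩
  rw [minimal_iff_forall_sdiff_singleton hmono] at hT
  refine ⟨T, hT.1, fun t ht ↦ ?_⟩
  by_contra! hshared
  refine hT.2 t ht fun a b hab ↦ ?_
  obtain ⟨u, hu, hub⟩ := hT.1 a b hab
  obtain rfl | hut := eq_or_ne u t
  · obtain ⟨u', hu', hub', hne⟩ := hshared b hub
    exact ⟨u', ⟨hu', hne⟩, hub'⟩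
  · exact ⟨u, ⟨hu, hut⟩, hub⟩

theorem exists_mem_and_mem_iff_of_disjoint {V : Type*} {A B : Set V} (hAB : Disjoint A B)
    {a a' b b' : V} (ha : a ∈ A) (ha' : a' ∈ A) (hb : b ∈ B) (hb' : b' ∈ B) :
    (∃ v, v ∈ s(a, b) ∧ v ∈ s(a', b')) ↔ a' = a ∨ b' = b := by
  have hab' := hAB.ne_of_mem ha hb'
  have ha'b := hAB.ne_of_mem ha' hb
  simp only [Sym2.mem_iff]
  constructor
  · rintro ⟨v, rfl | rfl, rfl | rfl⟩ <;> simp_all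
  · rintro (rfl | rfl)
    exacts [⟨a', by simp⟩, ⟨b', by simp⟩]

theorem forall_mem_edgeSet_of_isBipartiteWith {V : Type*} {H : SimpleGraph V} {A B : Set V}
    (hH : H.IsBipartiteWith A B) {P : Sym2 V → Prop}
    (h : ∀ a ∈ A, ∀ b ∈ B, H.Adj a b → P s(a, b)) : ∀ e ∈ H.edgeSet, P e := by
  refine Sym2.ind fun u w huw ↦ ?_
  obtain ⟨hu, hw⟩ | ⟨hu, hw⟩ := hH.mem_of_adj huw
  · exact h u hu w hw huw
  · exact Sym2.eq_swap ▸ h w hw u hu huw.symm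

theorem meetsOnce_image_of_disjoint {V ι : Type*} {A B : Set V} (hAB : Disjoint A B) {J : Set ι}
    {x y : ι → V} (hx : MapsTo x J A) (hy : MapsTo y J B) {a b : V} (ha : a ∈ A) (hb : b ∈ B)
    (h : ∃! j, j ∈ J ∧ (x j = a ∨ y j = b)) :
    MeetsOnce ((fun j ↦ s(x j, y j)) '' J) s(a, b) := by
  have hmeet (j) (hj : j ∈ J) : (∃ v, v ∈ s(a, b) ∧ v ∈ s(x j, y j)) ↔ x j = a ∨ y j = b :=
    exists_mem_and_mem_iff_of_disjoint hAB ha (hx hj) hb (hy hj)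
  obtain ⟨j, ⟨hj, hja⟩, huniq⟩ := h
  refine ⟨s(x j, y j), ⟨mem_image_of_mem _ hj, (hmeet j hj).2 hja⟩, ?_⟩
  rintro _ ⟨⟨i, hi, rfl⟩, hi'⟩
  rw [huniq i ⟨hi, (hmeet i hi).1 hi'⟩]

theorem exists_dominating_forall_exists_private_neighbor {V : Type*} [Finite V]
    (H : SimpleGraph V) (A B : Set V) :
    ∃ T ⊆ A, (∀ a ∈ A, ∀ b ∈ B, H.Adj a b → ∃ t ∈ T, H.Adj t b) ∧
      ∀ t ∈ T, ∃ b ∈ B, H.Adj t b ∧ ∀ u ∈ T, H.Adj u b → u = t := by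
  obtain ⟨T, hdom, hpriv⟩ :=
    exists_dominating_forall_exists_private fun a b ↦ a ∈ A ∧ b ∈ B ∧ H.Adj a b
  have hTA : T ⊆ A := fun t ht ↦ (hpriv t ht).choose_spec.1.1
  refine ⟨T, hTA, fun a ha b hb hab ↦ ?_, fun t ht ↦ ?_⟩
  · obtain ⟨t, ht, -, -, htb⟩ := hdom a b ⟨ha, hb, hab⟩
    exact ⟨t, ht, htb⟩
  · obtain ⟨b, ⟨-, hb, htb⟩, huniq⟩ := hpriv t ht
    exact ⟨b, hb, htb, fun u hu hub ↦ huniq u hu ⟨hTA hu, hb, hub⟩⟩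

section Bipartite

variable {V : Type*} {H : SimpleGraph V} {A B T : Set V} {p : V → V}

theorem meetsOnce_private_edges (hAB : Disjoint A B) (hT : T ⊆ A) (hp : MapsTo p T B)
    (hadj : ∀ t ∈ T, H.Adj t (p t)) (hpriv : ∀ t ∈ T, ∀ u ∈ T, H.Adj u (p t) → u = t)
    {a b : V} (ha : a ∈ A) (hb : b ∈ B) (hab : H.Adj a b) (h : a ∈ T ∨ b ∈ p '' T) :
    MeetsOnce ((fun t ↦ s(t, p t)) '' T) s(a, b) := by
  refine meetsOnce_image_of_disjoint hAB hT hp ha hb ?_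
  have hp_inj : InjOn p T := fun t ht u hu htu ↦ hpriv u hu t ht (htu ▸ hadj t ht)
  have hpriv_a (haT : a ∈ T) (t) (ht : t ∈ T) (htb : p t = b) : a = t :=
    hpriv t ht a haT (htb ▸ hab)
  by_cases haT : a ∈ T
  · refine ⟨a, ⟨haT, .inl rfl⟩, ?_⟩
    rintro u ⟨hu, rfl | hub⟩
    exacts [rfl, (hpriv_a haT u hu hub).symm]
  · obtain ⟨t, ht, rfl⟩ := h.resolve_left haT
    refine ⟨t, ⟨ht, .inr rfl⟩, ?_⟩
    rintro u ⟨hu, rfl | hut⟩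
    exacts [absurd hu haT, hp_inj hu ht hut]

theorem meetsOnce_star_edges (hAB : Disjoint A B) (hT : T ⊆ A) {D : Set V} (hD : D ⊆ B)
    {q : V → V} (hq : MapsTo q D T) {a b : V} (ha : a ∈ A) (haT : a ∉ T) (hb : b ∈ D) :
    MeetsOnce ((fun d ↦ s(q d, d)) '' D) s(a, b) := by
  refine meetsOnce_image_of_disjoint hAB (hq.mono_right hT) (y := id) hD ha (hD hb)
    ⟨b, ⟨hb, .inr rfl⟩, ?_⟩
  rintro d ⟨hd, rfl | hdb⟩
  exacts [absurd (hq hd) haT, hdb]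

theorem disjoint_private_edges_star_edges (hAB : Disjoint A B) (hT : T ⊆ A) {D : Set V}
    (hD : D ⊆ B) (hDp : Disjoint D (p '' T)) {q : V → V} :
    Disjoint ((fun t ↦ s(t, p t)) '' T) ((fun d ↦ s(q d, d)) '' D) := by
  rw [Set.disjoint_left]
  rintro _ ⟨t, ht, rfl⟩ ⟨d, hd, hdt⟩
  obtain ⟨-, h⟩ | ⟨-, h⟩ := Sym2.eq_iff.1 hdt
  · exact Set.disjoint_left.1 hDp hd ⟨t, ht, h.symm⟩
  · exact hAB.ne_of_mem (hT ht) (hD hd) h.symm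

theorem exists_isConflictFreeFamily_of_isBipartiteWith [Finite V] (hH : H.IsBipartiteWith A B) :
    ∃ M : Fin 2 → Set (Sym2 V), IsConflictFreeFamily H M := by
  have hAB := hH.disjoint
  obtain ⟨T, hTA, hdom, hpriv⟩ := exists_dominating_forall_exists_private_neighbor H A B
  choose! p hpB hp_adj hp_priv using hpriv
  let D : Set V := {b | b ∈ B ∧ ∃ a ∈ A, H.Adj a b} \ p '' T
  have hDB : D ⊆ B := fun b hb ↦ hb.1.1
  have hD (b) (hb : b ∈ D) : ∃ t ∈ T, H.Adj t b :=
    let ⟨a, ha, hab⟩ := hb.1.2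
    hdom a ha b hb.1.1 hab
  choose! q hqT hq_adj using hD
  refine ⟨_, .of_pair (M := (fun t ↦ s(t, p t)) '' T) (N := (fun d ↦ s(q d, d)) '' D)
    (image_subset_iff.2 hp_adj) (image_subset_iff.2 hq_adj)
    (disjoint_private_edges_star_edges hAB hTA hDB disjoint_sdiff_left)
    (forall_mem_edgeSet_of_isBipartiteWith hH fun a ha b hb hab ↦ ?_)⟩
  by_cases h : a ∈ T ∨ b ∈ p '' T
  · exact .inl (meetsOnce_private_edges hAB hTA hpB hp_adj hp_priv ha hb hab h)
  · rw [not_or] at h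
    exact .inr (meetsOnce_star_edges hAB hTA hDB hqT ha h.1 ⟨⟨hb, a, ha, hab⟩, h.2⟩)

end Bipartite

theorem exists_signs_mul_mulVec_le_diag {V R : Type*} [Fintype V] [CommRing R] [LinearOrder R]
    [IsStrictOrderedRing R] {A : Matrix V V R} (hA : A.IsSymm) :
    ∃ x : V → R, (∀ v, x v = 1 ∨ x v = -1) ∧ ∀ v, x v * (A *ᵥ x) v ≤ A v v := by
  classical
  let signs : Set (V → R) := univ.pi fun _ ↦ {1, -1}
  obtain ⟨x, hx, hmin⟩ := exists_min_image signs (fun y ↦ y ⬝ᵥ A *ᵥ y)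
    (.pi fun _ ↦ toFinite _) ⟨1, fun _ _ ↦ .inl rfl⟩
  have hx (v) : x v = 1 ∨ x v = -1 := hx v (mem_univ v)
  refine ⟨x, hx, fun v ↦ ?_⟩
  let y : V → R := x - Pi.single v (2 * x v)
  have hy : y ∈ signs := fun u _ ↦ by
    obtain rfl | huv := eq_or_ne u v
    · have := hx u
      simp only [y, Pi.sub_apply, Pi.single_eq_same, mem_insert_iff, mem_singleton_iff]
      grind
    · simpa [y, huv] using hx u
  have hcol : x ⬝ᵥ A.col v = (A *ᵥ x) v := by
    rw [dotProduct_comm, ← Matrix.row_transpose, hA.eq]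
    rfl
  have hflip : y ⬝ᵥ A *ᵥ y = x ⬝ᵥ A *ᵥ x - 4 * (x v * (A *ᵥ x) v) + 4 * (x v ^ 2 * A v v) := by
    simp only [y, Matrix.mulVec_sub, sub_dotProduct, dotProduct_sub, Matrix.mulVec_single,
      dotProduct_smul, hcol, single_dotProduct, Matrix.col_apply,
      op_smul_eq_smul, smul_eq_mul]
    ring
  have hsq : x v ^ 2 = 1 := sq_eq_one_iff.2 (hx v)
  have := hmin y hy
  rw [hflip, hsq] at this
  linarith

theorem exists_two_mul_degree_sdiff_between_compl_le {V : Type*} [Fintype V] (G : SimpleGraph V)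
    [DecidableRel G.Adj] :
    ∃ (S : Set V) (_ : DecidablePred (· ∈ S)),
      ∀ v, 2 * (G \ G.between S Sᶜ).degree v ≤ G.degree v := by
  obtain ⟨x, hx, hle⟩ := exists_signs_mul_mulVec_le_diag (G.isSymm_adjMatrix (α := ℤ))
  let S : Set V := {v | x v = 1}
  have : DecidablePred (· ∈ S) := Classical.decPred _
  refine ⟨S, this, fun v ↦ ?_⟩
  let I := G \ G.between S Sᶜ
  have hmul (w) (hw : w ∈ G.neighborFinset v) :
      x v * x w = 2 * (if I.Adj v w then 1 else 0) - 1 := by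
    have hvw : G.Adj v w := by simpa using hw
    obtain hv | hv := hx v <;> obtain hw | hw := hx w <;>
      simp [I, S, sdiff_adj, between_adj, hvw, hv, hw]
  have hI : {w ∈ G.neighborFinset v | I.Adj v w} = I.neighborFinset v := by
    have hIG (w) (h : I.Adj v w) : G.Adj v w := h.1
    ext w
    simpa using hIG w
  have hsum : x v * (G.adjMatrix ℤ *ᵥ x) v = 2 * I.degree v - G.degree v := by
    rw [adjMatrix_mulVec_apply, Finset.mul_sum, Finset.sum_congr rfl hmul, Finset.sum_sub_distrib,
      ← Finset.mul_sum, Finset.sum_boole, hI]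
    simp
  have hle_zero : (2 * I.degree v - G.degree v : ℤ) ≤ 0 :=
    hsum ▸ (hle v).trans_eq (by simp)
  change 2 * I.degree v ≤ G.degree v
  lia

section MaximumDegreeTwo

variable {α : Type*} (L : SimpleGraph α)

theorem exists_packing_forall_exists_adj [Finite α] :
    ∃ M : Set α, (∀ z, (M ∩ insert z (L.neighborSet z)).Subsingleton) ∧
      ∀ x, Disjoint M (insert x (L.neighborSet x)) →
        ∃ z, L.Adj x z ∧ ¬ Disjoint M (insert z (L.neighborSet z)) := by
  let IsPacking (M : Set α) : Prop := ∀ z, (M ∩ insert z (L.neighborSet z)).Subsingleton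
  obtain ⟨M, -, hM⟩ := Finite.exists_le_maximal (p := IsPacking) (a := ∅) (by simp [IsPacking])
  have hanti ⦃M N : Set α⦄ (hN : IsPacking N) (hMN : M ⊆ N) : IsPacking M := fun z ↦
    (hN z).anti (inter_subset_inter_left _ hMN)
  rw [maximal_iff_forall_insert hanti] at hM
  refine ⟨M, hM.1, fun x hx ↦ ?_⟩
  have hxM : x ∉ M := fun h ↦ Set.disjoint_left.1 hx h (mem_insert _ _)
  by_contra! hfar
  refine hM.2 x hxM fun z ↦ ?_
  by_cases hz : x ∈ insert z (L.neighborSet z)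
  · have hMz : Disjoint M (insert z (L.neighborSet z)) := by
      obtain rfl | hzx := hz
      exacts [hx, hfar z hzx.symm]
    rw [insert_inter_of_mem hz, hMz.inter_eq]
    simp
  · rw [insert_inter_of_notMem hz]
    exact hM.1 z

theorem exists_subset_existsUnique_mem_closedNeighborhood [Finite α] {U : Set α}
    (hU : ∀ x ∈ U, (U ∩ L.neighborSet x).Subsingleton) :
    ∃ N ⊆ U, ∀ x ∈ U, ∃! y, y ∈ N ∧ y ∈ insert x (L.neighborSet x) := by
  obtain ⟨N, -, hN⟩ := Finite.exists_le_maximal (p := fun N ↦ N ⊆ U ∧ L.IsIndepSet N) (a := ∅)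
    (by simp)
  rw [maximal_iff_forall_insert fun M N hN hMN ↦ ⟨hMN.trans hN.1, hN.2.mono hMN⟩] at hN
  obtain ⟨⟨hNU, hindep⟩, hmax⟩ := hN
  refine ⟨N, hNU, fun x hx ↦ ?_⟩
  by_cases hxN : x ∈ N
  · refine ⟨x, ⟨hxN, mem_insert _ _⟩, ?_⟩
    rintro y ⟨hy, rfl | hxy⟩
    exacts [rfl, absurd hxy (hindep hxN hy hxy.ne)]
  · obtain ⟨y, hy, hxy⟩ : ∃ y ∈ N, L.Adj x y := by
      by_contra! hfar
      refine hmax x hxN ⟨insert_subset hx hNU, hindep.insert fun y hy _ ↦ ?_⟩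
      exact ⟨hfar y hy, fun h ↦ hfar y hy h.symm⟩
    refine ⟨y, ⟨hy, .inr hxy⟩, ?_⟩
    rintro z ⟨hz, rfl | hxz⟩
    exacts [absurd hz hxN, hU x hx ⟨hNU hz, hxz⟩ ⟨hNU hy, hxy⟩]

theorem exists_disjoint_existsUnique_mem_closedNeighborhood [Finite α]
    (hL : ∀ x, (L.neighborSet x).encard ≤ 2) :
    ∃ M N : Set α, Disjoint M N ∧ ∀ x, (∃! y, y ∈ M ∧ y ∈ insert x (L.neighborSet x)) ∨
      ∃! y, y ∈ N ∧ y ∈ insert x (L.neighborSet x) := by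
  obtain ⟨M, hM, hmax⟩ := exists_packing_forall_exists_adj L
  let U : Set α := {x | Disjoint M (insert x (L.neighborSet x))}
  -- One of the at most two neighbours of `x` already meets `M`, so at most one lies in `U`.
  have hU (x) (hx : x ∈ U) : (U ∩ L.neighborSet x).Subsingleton := by
    obtain ⟨z, hxz, hz⟩ := hmax x hx
    have hsub : U ∩ L.neighborSet x ⊆ L.neighborSet x \ {z} :=
      fun y hy ↦ ⟨hy.2, fun h ↦ hz (h ▸ hy.1)⟩
    rw [← encard_le_one_iff_subsingleton]
    have hz_card := encard_sdiff_singleton_add_one (s := L.neighborSet x) hxz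
    have hle : (L.neighborSet x \ {z}).encard + 1 ≤ 1 + 1 := hz_card.trans_le (hL x)
    exact (encard_le_encard hsub).trans ((ENat.add_le_add_iff_right ENat.one_ne_top).1 hle)
  obtain ⟨N, hNU, hN⟩ := exists_subset_existsUnique_mem_closedNeighborhood L hU
  refine ⟨M, N, ?_, fun x ↦ ?_⟩
  · rw [Set.disjoint_right]
    exact fun x hx hxM ↦ Set.disjoint_left.1 (hNU hx) hxM (mem_insert _ _)
  · by_cases hx : x ∈ U
    · exact .inr (hN x hx)
    · obtain ⟨y, hy⟩ := Set.not_disjoint_iff.1 hx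
      exact .inl ⟨y, hy, fun z hz ↦ hM x hz hy⟩

end MaximumDegreeTwo

theorem encard_neighborSet_lineGraph_le {V : Type*} {G : SimpleGraph V} [G.LocallyFinite] {d : ℕ}
    (h : ∀ v, G.degree v ≤ d + 1) (e : G.edgeSet) :
    (G.lineGraph.neighborSet e).encard ≤ 2 * d := by
  classical
  obtain ⟨⟨u, w⟩, he⟩ := e
  let others (v : V) : Set (Sym2 V) := G.incidenceSet v \ {s(u, w)}
  have hothers (v) (hv : v ∈ s(u, w)) : (others v).encard ≤ d := by
    have hmem : s(u, w) ∈ G.incidenceSet v := ⟨he, hv⟩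
    have hcard : (others v).encard + 1 = G.degree v := by
      rw [encard_sdiff_singleton_add_one hmem, ← coe_incidenceFinset, encard_coe_eq_coe_finsetCard,
        card_incidenceFinset_eq_degree]
    have hle : (others v).encard + 1 ≤ d + 1 := hcard.trans_le (by exact_mod_cast h v)
    exact (ENat.add_le_add_iff_right ENat.one_ne_top).1 hle
  have hsub : Subtype.val '' G.lineGraph.neighborSet ⟨s(u, w), he⟩ ⊆ others u ∪ others w := by
    rintro _ ⟨f, hf, rfl⟩
    obtain ⟨hne, v, hv, hvf⟩ := lineGraph_adj_iff_exists.1 hf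
    have hfe : (f : Sym2 V) ≠ s(u, w) := fun h ↦ hne (Subtype.ext h.symm)
    obtain rfl | rfl := Sym2.mem_iff.1 hv
    exacts [.inl ⟨⟨f.2, hvf⟩, hfe⟩, .inr ⟨⟨f.2, hvf⟩, hfe⟩]
  calc (G.lineGraph.neighborSet _).encard
      = (Subtype.val '' G.lineGraph.neighborSet ⟨s(u, w), he⟩).encard :=
        (Subtype.val_injective.encard_image _).symm
    _ ≤ (others u).encard + (others w).encard := (encard_le_encard hsub).trans (encard_union_le _ _)
    _ ≤ d + d := add_le_add (hothers u (by simp)) (hothers w (by simp))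
    _ = 2 * d := (two_mul _).symm

theorem exists_mem_and_mem_iff_mem_insert_lineGraph_neighborSet {V : Type*} {G : SimpleGraph V}
    {e f : G.edgeSet} :
    (∃ v, v ∈ (e : Sym2 V) ∧ v ∈ (f : Sym2 V)) ↔ f ∈ insert e (G.lineGraph.neighborSet e) := by
  rw [mem_insert_iff, mem_neighborSet, lineGraph_adj_iff_exists]
  obtain rfl | hne := eq_or_ne f e
  · simpa using ⟨_, (f : Sym2 V).out_fst_mem⟩
  · simp [hne, hne.symm]

theorem meetsOnce_image_val_iff {V : Type*} {G : SimpleGraph V} {M : Set G.edgeSet}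
    {e : G.edgeSet} :
    MeetsOnce (Subtype.val '' M) (e : Sym2 V) ↔
      ∃! f, f ∈ M ∧ f ∈ insert e (G.lineGraph.neighborSet e) := by
  simp only [← exists_mem_and_mem_iff_mem_insert_lineGraph_neighborSet]
  constructor
  · rintro ⟨_, ⟨⟨f, hf, rfl⟩, hef⟩, huniq⟩
    exact ⟨f, ⟨hf, hef⟩, fun g hg ↦
      Subtype.ext (huniq g ⟨mem_image_of_mem _ hg.1, hg.2⟩)⟩
  · rintro ⟨f, ⟨hf, hef⟩, huniq⟩
    refine ⟨f, ⟨mem_image_of_mem _ hf, hef⟩, ?_⟩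
    rintro _ ⟨⟨g, hg, rfl⟩, heg⟩
    exact congrArg _ (huniq g ⟨hg, heg⟩)

theorem exists_isConflictFreeFamily_of_degree_le_two {V : Type*} [Finite V] {G : SimpleGraph V}
    [G.LocallyFinite] (h : ∀ v, G.degree v ≤ 2) :
    ∃ M : Fin 2 → Set (Sym2 V), IsConflictFreeFamily G M := by
  obtain ⟨M, N, hMN, hcover⟩ := exists_disjoint_existsUnique_mem_closedNeighborhood G.lineGraph
    fun e ↦ by simpa using encard_neighborSet_lineGraph_le (d := 1) h e
  refine ⟨_, .of_pair (M := Subtype.val '' M) (N := Subtype.val '' N) (Subtype.coe_image_subset _ _)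
    (Subtype.coe_image_subset _ _) (disjoint_image_of_injective Subtype.val_injective hMN)
    fun e he ↦ ?_⟩
  simpa only [← meetsOnce_image_val_iff] using hcover ⟨e, he⟩

theorem conflictFreeChromaticIndex_le_one_of_degree_le_one {V : Type*} {G : SimpleGraph V}
    [G.LocallyFinite] (h : ∀ v, G.degree v ≤ 1) : G.conflictFreeChromaticIndex ≤ 1 := by
  refine conflictFreeChromaticIndex_le_of_coloring (k := 1) (c := fun _ ↦ 0) fun e ↦ ?_
  have hisolated : G.lineGraph.neighborSet e = ∅ := by
    simpa using encard_neighborSet_lineGraph_le (d := 0) h e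
  have hnbhd (f) : f ∈ G.edgeClosedNbhd e ↔ f = e :=
    exists_mem_and_mem_iff_mem_insert_lineGraph_neighborSet.trans (by simp [hisolated])
  exact ⟨0, e, by simp [hnbhd]⟩

theorem exists_isConflictFreeFamily_of_degree_le_two_pow {V : Type*} [Fintype V] (k : ℕ)
    {G : SimpleGraph V} [DecidableRel G.Adj] (h : ∀ v, G.degree v ≤ 2 ^ (k + 1)) :
    ∃ M : Fin (2 * (k + 1)) → Set (Sym2 V), IsConflictFreeFamily G M := by
  induction k generalizing G with
  | zero => exact exists_isConflictFreeFamily_of_degree_le_two (by simpa using h)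
  | succ k ih =>
    obtain ⟨S, _, hS⟩ := exists_two_mul_degree_sdiff_between_compl_le G
    have hdeg (v) : (G \ G.between S Sᶜ).degree v ≤ 2 ^ (k + 1) := by
      have hhalf := (hS v).trans (h v)
      rw [pow_succ'] at hhalf
      lia
    obtain ⟨M, hM⟩ := ih hdeg
    obtain ⟨N, hN⟩ := exists_isConflictFreeFamily_of_isBipartiteWith
      (G.between_isBipartiteWith disjoint_compl_right)
    have hMN := hM.append hN disjoint_sdiff_self_left
    rw [sdiff_sup_cancel between_le] at hMN
    exact ⟨_, hMN⟩

theorem mainTheorem3_general {V : Type*} [Fintype V] {G : SimpleGraph V} [DecidableRel G.Adj]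
    {k : ℕ} (h : G.maxDegree ≤ 2 ^ k) :
    G.conflictFreeChromaticIndex ≤ (2 * k + 1 : ℕ) := by
  have hdeg (v) : G.degree v ≤ 2 ^ k := (G.degree_le_maxDegree v).trans h
  cases k with
  | zero => simpa using conflictFreeChromaticIndex_le_one_of_degree_le_one hdeg
  | succ k =>
    obtain ⟨M, hM⟩ := exists_isConflictFreeFamily_of_degree_le_two_pow k hdeg
    exact hM.conflictFreeChromaticIndex_le

theorem mainTheorem3 {V : Type*} [Fintype V] (G : SimpleGraph V) [DecidableRel G.Adj]
    (hG : ∀ v : V, ¬ G.IsIsolated v) :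
    G.conflictFreeChromaticIndex ≤ ((3 * ⌈Real.logb 2 (G.maxDegree : ℝ)⌉₊ + 1 : ℕ) : ℕ∞) := by
  have hΔ : G.maxDegree ≤ 2 ^ ⌈Real.logb 2 (G.maxDegree : ℝ)⌉₊ := by
    simpa [← Real.natCeil_logb_natCast] using Nat.le_pow_clog one_lt_two G.maxDegree
  exact (mainTheorem3_general hΔ).trans (by gcongr; norm_num)
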